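/- Let $0\le r\le p$, $d\ge 0$, $n\ge 0$ be integers and $\sigma>0$. Let $\mathcal F_{p,d}$ be the set of all $W=(w_0,W_1,\dots,W_d)$ with $w_0\in\mathbb R^p$ and $W_i\in\mathbb R^{p\times p}$. **The full family $\mathcal P$.** A $d$-layer backwards generative network with parameter $W$ generates a label $y\in\{-1,+1\}$ from some law, and then $z_0\sim\eta_0(\,\cdot\mid y w_0)$, $z_i\sim\eta_i(\,\cdot\mid W_i\varphi(z_{i-1}))$ for $1\le i\le d$, and $x:=z_d$, where $\varphi:\mathbb R\to\mathbb R$ is a measurable activation applied componentwise and $\eta_0,\dots,\eta_d$ are Markov kernels on $\mathbb R^p$; the law of $y$, $\varphi$ and the $\eta_i$ do not depend on $W$. Let $\mathcal P$ be the set of all joint laws of $(W,S)$ in which $W$ has any probability law on $\mathcal F_{p,d}$ and, given $W$, the dataset $S=((x_j,y_j))_{j=1}^n$ consists of $n$ i.i.d. copies of $(x,y)$ generated by such a network. **The subfamily $\mathcal P'$.** Let $\mathcal G_{p,d,r}\subseteq\mathcal F_{p,d}$ be the finite set of all $W$ such that the $k$-th entry of $w_0$ is $\pm 2^{-\min(k,\,p-1)/2}$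 for $k=1,\dots,p$ (any signs), and every $W_i$ is block diagonal, $W_i=\begin{pmatrix}R_i&0\\0&cI_{p-r}\end{pmatrix}$, with $R_i$ any $r\times r$ permutation matrix and $c=\frac1{p-r+1}$. Let $\mathcal P'$ be the set whose only element is the joint law of $(W^*,S)$ when $W^*$ is uniform on $\mathcal G_{p,d,r}$ and, given $W^*=W$, $S$ consists of $n$ i.i.d. copies of $(x,y)$ generated by the linear-Gaussian network $$y\sim\mathrm{Uniform}\{-1,+1\},\quad z_0\mid y\sim N(yw_0,\sigma^2I_p),\quad z_i\mid z_{i-1}\sim N(W_iz_{i-1},\sigma^2I_p)\ (1\le i\le d),\quad x:=z_d .$$ **Theorem.** 1. $\mathcal P'\subseteq\mathcal P$, and if $$n\le\sigma^2\,\frac{d\sum_{i=1}^r\log i+p\log 2-\log 4}{4},$$ then $$\inf_{\hat f}\ \sup_{\mathbb P\in\mathcal P'}\ \mathbb P\bigl(\hat f(S)\ne W^*\bigr)\ \ge\ \frac12,$$ where the infimum runs over all decoders $\hat f:(\mathbb R^p\times\{-1,+1\})^n\to\mathcal G_{p,d,r}$. (Arbitrary functions are allowed; if the failure event is not measurable,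 its probability is read as outer measure.) 2. Consequently the lower bound is of order $\Omega(dr\log r+p)$: there is an absolute constant $C>0$ such that for all $p\ge 3$, $0\le r\le p$, $d\ge0$, $n\ge0$ and $\sigma>0$ with $n\le C\sigma^2(dr\log r+p)$ (where $0\log 0=0$), the same conclusion $\inf_{\hat f}\sup_{\mathbb P\in\mathcal P'}\mathbb P(\hat f(S)\ne W^*)\ge\frac12$ holds. -/

import Mathlib

open MeasureTheory ProbabilityTheory
open scoped NNReal ENNReal

namespace BackwardNet

noncomputable section

/-! ### Parameters, labels and samples -/

/-- Real matrices carry the product (Borel) sigma-algebra. -/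
instance matrixMeasurableSpace (m k : ℕ) : MeasurableSpace (Matrix (Fin m) (Fin k) ℝ) :=
  inferInstanceAs (MeasurableSpace (Fin m → Fin k → ℝ))

/-- The hypothesis class `F_{p,d}` (all layers of width `p`): pairs `(w₀, (W₁, …, W_d))`.
The matrix `W_i` is stored at index `i - 1`. -/
abbrev Param (p d : ℕ) : Type := (Fin p → ℝ) × (Fin d → Matrix (Fin p) (Fin p) ℝ)

/-- The label set `{-1, +1}`. -/
abbrev Label : Type := ↥({-1, 1} : Set ℝ)

/-- A labelled observation `(x, y)`. -/
abbrev Sample (p : ℕ) : Type := (Fin p → ℝ) × Label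

/-- A dataset of `n` labelled observations. -/
abbrev Data (p n : ℕ) : Type := Fin n → Sample p

/-! ### Products of Markov kernels -/

theorem measurable_pi_kernel {α ι : Type*} {β : ι → Type*} [Fintype ι] [MeasurableSpace α]
    [∀ i, MeasurableSpace (β i)] (κ : ∀ i, Kernel α (β i)) [∀ i, IsMarkovKernel (κ i)] :
    Measurable (fun a => Measure.pi (fun i => κ i a)) := by
  refine Measurable.measure_of_isPiSystem_of_isProbabilityMeasure
    generateFrom_pi.symm isPiSystem_pi ?_
  rintro s ⟨t, ht, rfl⟩
  simp only [Measure.pi_pi]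
  exact Finset.measurable_prod _ fun i _ =>
    (κ i).measurable_coe (ht i (Set.mem_univ i))

/-- The kernel sending `a` to the product measure of the `κ i a`. -/
def piKernel {α ι : Type*} {β : ι → Type*} [Fintype ι] [MeasurableSpace α]
    [∀ i, MeasurableSpace (β i)] (κ : ∀ i, Kernel α (β i)) [∀ i, IsMarkovKernel (κ i)] :
    Kernel α (∀ i, β i) where
  toFun a := Measure.pi (fun i => κ i a)
  measurable' := measurable_pi_kernel κ

instance isMarkovKernel_piKernel {α ι : Type*} {β : ι → Type*} [Fintype ι] [MeasurableSpace α]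
    [∀ i, MeasurableSpace (β i)] (κ : ∀ i, Kernel α (β i)) [∀ i, IsMarkovKernel (κ i)] :
    IsMarkovKernel (piKernel κ) :=
  ⟨fun a => inferInstanceAs (IsProbabilityMeasure (Measure.pi (fun i => κ i a)))⟩

/-- `n` independent draws from `κ W`, given `W`. -/
def iidKernel {p d : ℕ} (n : ℕ) (κ : Kernel (Param p d) (Sample p)) [IsMarkovKernel κ] :
    Kernel (Param p d) (Data p n) :=
  piKernel (fun _ : Fin n => κ)

/-! ### The backwards generative network

A general network is given by a componentwise activation `φ`, a law of the label, and for each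
layer `i = 0, …, d` a Markov kernel `η i` on `ℝ^p`:
`y ∼ label`, `z_0 ∼ η 0 (y w₀)`, `z_i ∼ η i (W_i φ(z_{i-1}))` for `1 ≤ i ≤ d`, and `x = z_d`. -/

/-- The preactivation of layer `0`, namely `y w₀`. -/
def inputMap {p d : ℕ} (a : Param p d × Label) : Fin p → ℝ := (a.2 : ℝ) • a.1.1

theorem measurable_inputMap {p d : ℕ} : Measurable (inputMap (p := p) (d := d)) := by
  refine measurable_pi_lambda _ fun k => ?_
  have h1 : Measurable fun a : Param p d × Label => (a.2 : ℝ) :=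
    measurable_subtype_coe.comp measurable_snd
  have h2 : Measurable fun a : Param p d × Label => a.1.1 k :=
    (measurable_pi_apply k).comp (measurable_fst.comp measurable_fst)
  exact h1.mul h2

/-- The preactivation of the layer with matrix `W.2 i`, namely `(W.2 i) φ(z)`. -/
def layerMap {p d : ℕ} (φ : ℝ → ℝ) (i : Fin d) (a : (Param p d × Label) × (Fin p → ℝ)) :
    Fin p → ℝ :=
  (a.1.1.2 i).mulVec (fun k => φ (a.2 k))

theorem measurable_layerMap {p d : ℕ} {φ : ℝ → ℝ} (hφ : Measurable φ) (i : Fin d) :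
    Measurable (layerMap (p := p) φ i) := by
  refine measurable_pi_lambda _ fun k => ?_
  change Measurable fun a : (Param p d × Label) × (Fin p → ℝ) => ∑ l, a.1.1.2 i k l * φ (a.2 l)
  refine Finset.measurable_sum _ fun l _ => ?_
  have h1 : Measurable fun a : (Param p d × Label) × (Fin p → ℝ) => a.1.1.2 i :=
    (measurable_pi_apply i).comp (measurable_snd.comp (measurable_fst.comp measurable_fst))
  have h0 : Measurable fun M : Matrix (Fin p) (Fin p) ℝ => M k l :=
    (measurable_pi_apply l).comp (measurable_pi_apply (X := fun _ : Fin p => Fin p → ℝ) k)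
  have h2 : Measurable fun a : (Param p d × Label) × (Fin p → ℝ) => a.2 l :=
    (measurable_pi_apply l).comp measurable_snd
  exact (h0.comp h1).mul (hφ.comp h2)

/-- The law of the latent vector `z_i` given the parameter and the label. -/
def latentKernel {p d : ℕ} (φ : ℝ → ℝ) (hφ : Measurable φ)
    (η : Fin (d + 1) → Kernel (Fin p → ℝ) (Fin p → ℝ)) (i : Fin (d + 1)) :
    Kernel (Param p d × Label) (Fin p → ℝ) :=
  Fin.induction (motive := fun _ => Kernel (Param p d × Label) (Fin p → ℝ))
    ((η 0).comap inputMap measurable_inputMap)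
    (fun i z => (z ⊗ₖ (η i.succ).comap (layerMap φ i) (measurable_layerMap hφ i)).snd) i

instance isMarkovKernel_latentKernel {p d : ℕ} (φ : ℝ → ℝ) (hφ : Measurable φ)
    (η : Fin (d + 1) → Kernel (Fin p → ℝ) (Fin p → ℝ)) [∀ i, IsMarkovKernel (η i)]
    (i : Fin (d + 1)) : IsMarkovKernel (latentKernel φ hφ η i) := by
  induction i using Fin.induction with
  | zero =>
    exact inferInstanceAs (IsMarkovKernel ((η 0).comap inputMap measurable_inputMap))
  | succ i ih =>
    exact inferInstanceAs (IsMarkovKernel ((latentKernel φ hφ η i.castSucc) ⊗ₖ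
      (η i.succ).comap (layerMap φ i) (measurable_layerMap hφ i)).snd)

/-- The law of `(x, y)` given the parameter: `y ∼ label` and `x = z_d`. -/
def networkKernel {p d : ℕ} (φ : ℝ → ℝ) (hφ : Measurable φ) (label : Measure Label)
    (η : Fin (d + 1) → Kernel (Fin p → ℝ) (Fin p → ℝ)) : Kernel (Param p d) (Sample p) :=
  (Kernel.const (Param p d) label ⊗ₖ latentKernel φ hφ η (Fin.last d)).swapRight

instance isMarkovKernel_networkKernel {p d : ℕ} (φ : ℝ → ℝ) (hφ : Measurable φ)
    (label : Measure Label) [IsProbabilityMeasure label]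
    (η : Fin (d + 1) → Kernel (Fin p → ℝ) (Fin p → ℝ)) [∀ i, IsMarkovKernel (η i)] :
    IsMarkovKernel (networkKernel φ hφ label η) := by
  unfold networkKernel; infer_instance

/-- All conditional laws of `(x, y)` given the parameter that are generated by `d`-layer networks,
with all activation functions and all distributions. -/
def networkModels (p d : ℕ) : Set (Kernel (Param p d) (Sample p)) :=
  {κ | ∃ (φ : ℝ → ℝ) (hφ : Measurable φ) (label : Measure Label)
      (η : Fin (d + 1) → Kernel (Fin p → ℝ) (Fin p → ℝ)),
      IsProbabilityMeasure label ∧ (∀ i, IsMarkovKernel (η i)) ∧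
      κ = networkKernel φ hφ label η}

theorem measurable_gaussianReal_coord {p : ℕ} (v : ℝ≥0) (k : Fin p) :
    Measurable (fun m : Fin p → ℝ => gaussianReal (m k) v) :=
  measurable_gaussianReal.comp (g := gaussianReal.uncurry) (f := fun m : Fin p → ℝ => (m k, v))
    ((measurable_pi_apply k).prodMk measurable_const)

/-- The one-dimensional kernel `m ↦ N(m_k, v)`. -/
def gaussianCoord (p : ℕ) (v : ℝ≥0) (k : Fin p) : Kernel (Fin p → ℝ) ℝ where
  toFun m := gaussianReal (m k) v
  measurable' := measurable_gaussianReal_coord v k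

instance isMarkovKernel_gaussianCoord (p : ℕ) (v : ℝ≥0) (k : Fin p) :
    IsMarkovKernel (gaussianCoord p v k) :=
  ⟨fun m => inferInstanceAs (IsProbabilityMeasure (gaussianReal (m k) v))⟩

/-- The kernel `m ↦ N(m, v I_p)` (independent coordinates of variance `v`). -/
def gaussianKernel (p : ℕ) (v : ℝ≥0) : Kernel (Fin p → ℝ) (Fin p → ℝ) :=
  piKernel (gaussianCoord p v)

instance isMarkovKernel_gaussianKernel (p : ℕ) (v : ℝ≥0) : IsMarkovKernel (gaussianKernel p v) :=
  isMarkovKernel_piKernel _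

/-- The linear-Gaussian backwards network with variance `σ²`: `y` uniform on `{-1, +1}`, identity
activation, `z_0 ∼ N(y w₀, σ² I)`, `z_i ∼ N(W_i z_{i-1}, σ² I)`, `x = z_d`. -/
def linearGaussianModels (p d : ℕ) (σ : ℝ≥0) : Set (Kernel (Param p d) (Sample p)) :=
  {networkKernel id measurable_id (uniformOn Set.univ) (fun _ => gaussianKernel p (σ ^ 2))}

/-! ### Families of joint laws of the parameter and the data -/

/-- All joint laws `P(W) Pⁿ((x, y) | W)` with `P(W)` in `priors` and `P((x, y) | W)` in `models`. -/
def jointLaws {p d : ℕ} (n : ℕ) (priors : Set (Measure (Param p d)))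
    (models : Set (Kernel (Param p d) (Sample p))) : Set (Measure (Param p d × Data p n)) :=
  {P | ∃ π ∈ priors, ∃ κ ∈ models, ∃ _ : IsMarkovKernel κ, P = π ⊗ₘ iidKernel n κ}

/-- The full family: all priors on `F_{p,d}` and all networks. -/
def fullFamily (p d n : ℕ) : Set (Measure (Param p d × Data p n)) :=
  jointLaws n {π | IsProbabilityMeasure π} (networkModels p d)

/-! ### The finite class `G_{p,d,r}` -/

/-- Splitting of the `p` coordinates into the first `r` and the last `p - r`. -/
def blockEquiv {p r : ℕ} (h : r ≤ p) : Fin r ⊕ Fin (p - r) ≃ Fin p :=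
  finSumFinEquiv.trans (finCongr (Nat.add_sub_of_le h))

/-- Block diagonal matrices with an `r × r` permutation block and the block `c I_{p-r}`, where
`c = 1 / (p - r + 1)`. -/
def layerClass {p r : ℕ} (h : r ≤ p) : Set (Matrix (Fin p) (Fin p) ℝ) :=
  {W | ∃ τ : Equiv.Perm (Fin r),
    W = Matrix.reindex (blockEquiv h) (blockEquiv h)
      (Matrix.fromBlocks (τ.permMatrix ℝ) 0 0
        ((1 / ((p : ℝ) - (r : ℝ) + 1)) • (1 : Matrix (Fin (p - r)) (Fin (p - r)) ℝ)))}

/-- Vectors whose `k`-th coordinate (`k = 1, …, p`) is `± 1 / √(2 ^ min k (p - 1))`; the index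
`k : Fin p` below starts from `0`. -/
def signClass (p : ℕ) : Set (Fin p → ℝ) :=
  {w | ∀ k : Fin p, w k = 1 / √(2 ^ min ((k : ℕ) + 1) (p - 1)) ∨
    w k = -1 / √(2 ^ min ((k : ℕ) + 1) (p - 1))}

/-- The class `G_{p,d,r}`. -/
def netClass {p r : ℕ} (d : ℕ) (h : r ≤ p) : Set (Param p d) :=
  {W | W.1 ∈ signClass p ∧ ∀ i, W.2 i ∈ layerClass h}

/-- The subfamily: the prior is uniform on `G_{p,d,r}` and the network is linear-Gaussian. -/
def subFamily {p r : ℕ} (d n : ℕ) (h : r ≤ p) (σ : ℝ≥0) :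
    Set (Measure (Param p d × Data p n)) :=
  jointLaws n {uniformOn (netClass d h)} (linearGaussianModels p d σ)

/-! ### Decoders and the minimax risk -/

/-- Decoders: arbitrary functions from datasets to the class `G`. -/
abbrev Decoder {p d : ℕ} (n : ℕ) (G : Set (Param p d)) : Type := Data p n → G

/-- The probability that the decoder fails to recover the exact parameter (the outer measure of
the failure event, for decoders that are not measurable). -/
def failureProb {p d n : ℕ} {G : Set (Param p d)} (f : Decoder n G)
    (P : Measure (Param p d × Data p n)) : ℝ≥0∞ :=
  P {ω | (f ω.2 : Param p d) ≠ ω.1}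

/-- The minimax probability of failure of exact recovery over decoders into `G` and joint laws
in `Q`. -/
def minimaxFailure {p d n : ℕ} (G : Set (Param p d)) (Q : Set (Measure (Param p d × Data p n))) :
    ℝ≥0∞ :=
  ⨅ f : Decoder n G, ⨆ P ∈ Q, failureProb f P

end

end BackwardNet

/-!
The proof is a second-moment argument. A law `μ` is dominated by `ν` with constant `K` if
`(∫ f dμ)² ≤ K ∫ f² dν` for all measurable `f ≥ 0` (`ChiSqDominated`). Such bounds multiply over
products, and a common Markov kernel preserves them by Jensen's inequality, so no densities are
needed beyond the first Gaussian layer.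

For a parameter `W` in the finite class, the law of the data given `W` is compared with one
reference law that does not depend on `W`: the one with `w₀ = 0` and all permutations trivial. Two
facts make this work.

* Moving the mean of the first layer from `y w₀` to `0` costs `exp (‖w₀‖² / σ²) ≤ exp (1 / σ²)`
  (`chiSqDominated_gaussianKernel`, `sum_sq_le_one`), and the later layers add nothing
  (`chiSqDominated_latentKernel`). Over `n` observations the constant is `exp (n / σ²)`.
* Once `w₀ = 0`, the law does not see the permutations. Every layer is the reference layer followed
  by a permutation that commutes with it, and isotropic Gaussian noise is permutation invariant
  (`lintegral_latentKernel_comp_perm`, `lintegral_latentKernel_perm_layers`).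

Under the reference law the data are independent of the uniform parameter, so a decoder succeeds
with probability at most `1 / |G|`. By domination its true success probability `t` satisfies
`t² ≤ exp (n / σ²) / |G|`, which is at most `1 / 4` as soon as `n / σ² + log 4 ≤ log |G|`
(`half_le_compProd_decoding_failure`, `half_le_minimaxFailure`). Since `|G| = 2 ^ p * (r!) ^ d`
(`ncard_netClass`), this is weaker than the stated hypothesis on `n`. The explicit order of growth
follows from `r ^ r ≤ (r!)²`.
-/

namespace BackwardNet

/-! ### Chi-square domination -/

/-- `μ` is dominated by `ν` with chi-square constant `K`: `(∫ f dμ)² ≤ K ∫ f² dν` for every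
measurable `f ≥ 0`. When `μ ≪ ν` the best constant is `∫ (dμ/dν)² dν = 1 + χ²(μ ‖ ν)`; the dual
form makes no reference to a density. -/
def ChiSqDominated {α : Type*} [MeasurableSpace α] (K : ℝ≥0∞) (μ ν : Measure α) : Prop :=
  ∀ f : α → ℝ≥0∞, Measurable f → (∫⁻ x, f x ∂μ) ^ 2 ≤ K * ∫⁻ x, f x ^ 2 ∂ν

theorem sq_lintegral_mul_le {α : Type*} [MeasurableSpace α] (μ : Measure α) {f g : α → ℝ≥0∞}
    (hf : Measurable f) (hg : Measurable g) :
    (∫⁻ x, f x * g x ∂μ) ^ 2 ≤ (∫⁻ x, f x ^ 2 ∂μ) * ∫⁻ x, g x ^ 2 ∂μ := by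
  have h := ENNReal.lintegral_mul_le_Lp_mul_Lq μ Real.HolderConjugate.two_two
    hf.aemeasurable hg.aemeasurable
  calc (∫⁻ x, f x * g x ∂μ) ^ 2
      ≤ ((∫⁻ x, f x ^ (2 : ℝ) ∂μ) ^ (1 / 2 : ℝ) * (∫⁻ x, g x ^ (2 : ℝ) ∂μ) ^ (1 / 2 : ℝ)) ^ 2 :=
        pow_le_pow_left' h 2
    _ = _ := by
        rw [mul_pow, ← ENNReal.rpow_natCast, ← ENNReal.rpow_natCast, ← ENNReal.rpow_mul,
          ← ENNReal.rpow_mul]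
        norm_num

theorem sq_lintegral_le {α : Type*} [MeasurableSpace α] (μ : Measure α) [IsProbabilityMeasure μ]
    {f : α → ℝ≥0∞} (hf : Measurable f) :
    (∫⁻ x, f x ∂μ) ^ 2 ≤ ∫⁻ x, f x ^ 2 ∂μ := by
  simpa using sq_lintegral_mul_le μ hf (measurable_const (a := (1 : ℝ≥0∞)))

theorem ChiSqDominated.prod {α β : Type*} [MeasurableSpace α] [MeasurableSpace β]
    {K L : ℝ≥0∞} {μ ν : Measure α} {μ' ν' : Measure β} [SFinite μ'] [SFinite ν']
    (h : ChiSqDominated K μ ν) (h' : ChiSqDominated L μ' ν') :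
    ChiSqDominated (K * L) (μ.prod μ') (ν.prod ν') := by
  intro f hf
  rw [lintegral_prod _ hf.aemeasurable, lintegral_prod _ (hf.pow_const 2).aemeasurable]
  calc _ ≤ K * ∫⁻ x, (∫⁻ y, f (x, y) ∂μ') ^ 2 ∂ν := h _ hf.lintegral_prod_right'
    _ ≤ K * ∫⁻ x, L * ∫⁻ y, f (x, y) ^ 2 ∂ν' ∂ν := by
        gcongr with x
        exact h' _ (hf.comp measurable_prodMk_left)
    _ = _ := by
        rw [lintegral_const_mul _ (hf.pow_const 2).lintegral_prod_right', mul_assoc]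

theorem ChiSqDominated.map {α β : Type*} [MeasurableSpace α] [MeasurableSpace β]
    {K : ℝ≥0∞} {μ ν : Measure α} (h : ChiSqDominated K μ ν) {g : α → β} (hg : Measurable g) :
    ChiSqDominated K (μ.map g) (ν.map g) := by
  intro f hf
  rw [lintegral_map hf hg, lintegral_map (hf.pow_const 2) hg]
  exact h _ (hf.comp hg)

theorem ChiSqDominated.pi {n : ℕ} {α : Type*} [MeasurableSpace α] {K : Fin n → ℝ≥0∞}
    {μ ν : Fin n → Measure α} [∀ i, SigmaFinite (μ i)] [∀ i, SigmaFinite (ν i)]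
    (h : ∀ i, ChiSqDominated (K i) (μ i) (ν i)) :
    ChiSqDominated (∏ i, K i) (Measure.pi μ) (Measure.pi ν) := by
  induction n with
  | zero =>
    intro f hf
    have : ∀ i, IsProbabilityMeasure (ν i) := fun i => i.elim0
    rw [Subsingleton.elim μ ν]
    simpa using sq_lintegral_le (Measure.pi ν) hf
  | succ n ih =>
    have hμ := (measurePreserving_piFinSuccAbove μ 0).symm.map_eq
    have hν := (measurePreserving_piFinSuccAbove ν 0).symm.map_eq
    rw [Fin.prod_univ_succ, ← hμ, ← hν]
    exact ((h 0).prod (ih fun i => h i.succ)).map (MeasurableEquiv.measurable _)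

/-! ### Gaussian measures -/

theorem gaussianReal_eq_withDensity {v : ℝ≥0} (hv : v ≠ 0) (m : ℝ) :
    gaussianReal m v = (gaussianReal 0 v).withDensity
      (fun x => ENNReal.ofReal (Real.exp ((2 * m * x - m ^ 2) / (2 * v)))) := by
  rw [gaussianReal_of_var_ne_zero m hv, gaussianReal_of_var_ne_zero 0 hv,
    ← withDensity_mul _ (measurable_gaussianPDF 0 v) (by fun_prop)]
  congr 1
  ext x
  have hv' : (v : ℝ) ≠ 0 := by exact_mod_cast hv
  rw [Pi.mul_apply, gaussianPDF, gaussianPDF, ← ENNReal.ofReal_mul (gaussianPDFReal_nonneg _ _ _),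
    gaussianPDFReal, gaussianPDFReal, mul_assoc _ (Real.exp _), ← Real.exp_add]
  congr 3
  field_simp
  ring

theorem lintegral_exp_mul_gaussianReal (v : ℝ≥0) (t : ℝ) :
    ∫⁻ x, ENNReal.ofReal (Real.exp (t * x)) ∂(gaussianReal 0 v)
      = ENNReal.ofReal (Real.exp (v * t ^ 2 / 2)) := by
  rw [← ofReal_integral_eq_lintegral_ofReal (integrable_exp_mul_gaussianReal t)
    (ae_of_all _ fun x => (Real.exp_pos _).le)]
  have := mgf_gaussianReal (p := gaussianReal 0 v) (X := id) Measure.map_id t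
  simp only [mgf, id] at this
  rw [this]
  simp

theorem chiSqDominated_gaussianReal {v : ℝ≥0} (hv : v ≠ 0) (m : ℝ) :
    ChiSqDominated (ENNReal.ofReal (Real.exp (m ^ 2 / v))) (gaussianReal m v)
      (gaussianReal 0 v) := by
  intro f hf
  have hv' : (v : ℝ) ≠ 0 := by exact_mod_cast hv
  rw [gaussianReal_eq_withDensity hv m,
    lintegral_withDensity_eq_lintegral_mul _ (by fun_prop) hf]
  refine (sq_lintegral_mul_le _ (by fun_prop) hf).trans (le_of_eq ?_)
  congr 1
  have h (x : ℝ) : ENNReal.ofReal (Real.exp ((2 * m * x - m ^ 2) / (2 * v))) ^ 2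
      = ENNReal.ofReal (Real.exp (-(m ^ 2 / v)))
        * ENNReal.ofReal (Real.exp ((2 * m / v) * x)) := by
    rw [← ENNReal.ofReal_pow (Real.exp_pos _).le, ← ENNReal.ofReal_mul (Real.exp_pos _).le,
      ← Real.exp_nat_mul, ← Real.exp_add]
    congr 2
    field_simp
    push_cast
    ring
  simp_rw [h]
  rw [lintegral_const_mul _ (by fun_prop), lintegral_exp_mul_gaussianReal,
    ← ENNReal.ofReal_mul (Real.exp_pos _).le, ← Real.exp_add]
  congr 2
  field_simp
  ring

theorem chiSqDominated_gaussianKernel {p : ℕ} {v : ℝ≥0} (hv : v ≠ 0) (m : Fin p → ℝ) :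
    ChiSqDominated (ENNReal.ofReal (Real.exp ((∑ k, m k ^ 2) / v))) (gaussianKernel p v m)
      (gaussianKernel p v 0) := by
  have h : ENNReal.ofReal (Real.exp ((∑ k, m k ^ 2) / v))
      = ∏ k, ENNReal.ofReal (Real.exp (m k ^ 2 / v)) := by
    rw [← ENNReal.ofReal_prod_of_nonneg fun _ _ => (Real.exp_pos _).le, ← Real.exp_sum,
      Finset.sum_div]
  rw [h]
  exact ChiSqDominated.pi (μ := fun k => gaussianReal (m k) v) (ν := fun _ => gaussianReal 0 v)
    fun k => chiSqDominated_gaussianReal hv (m k)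

theorem lintegral_gaussianKernel_comp_perm {p : ℕ} (v : ℝ≥0) (m : Fin p → ℝ)
    (π : Equiv.Perm (Fin p)) {f : (Fin p → ℝ) → ℝ≥0∞} (hf : Measurable f) :
    ∫⁻ x, f (x ∘ π) ∂(gaussianKernel p v m) = ∫⁻ x, f x ∂(gaussianKernel p v (m ∘ π)) := by
  have h := measurePreserving_piCongrLeft (α := fun _ : Fin p => ℝ)
    (fun k => gaussianReal (m (π k)) v) π.symm
  simp only [Equiv.apply_symm_apply] at h
  have he (x : Fin p → ℝ) :
      MeasurableEquiv.piCongrLeft (fun _ : Fin p => ℝ) π.symm x = x ∘ π := by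
    funext k
    obtain ⟨j, rfl⟩ := π.symm.surjective k
    simp [MeasurableEquiv.coe_piCongrLeft, Equiv.piCongrLeft_apply_apply]
  have h2 := h.lintegral_comp hf
  simp_rw [he] at h2
  exact h2

/-! ### Decoding under chi-square domination -/

/-- If every `κ w` is dominated by one law `ν` and the prior `U` has atoms of mass at most `ε`,
then any set of pairs `(w, s)` containing at most one `w` for each `s` has probability at most
`√(K ε)`: under `U × ν` its probability is at most `ε`, and domination carries this over. -/
theorem sq_compProd_le_of_subset_graph {α β : Type*} [MeasurableSpace α] [MeasurableSpace β]
    {U : Measure α} [IsProbabilityMeasure U] {κ : Kernel α β} [IsMarkovKernel κ]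
    {ν : Measure β} [IsProbabilityMeasure ν] {K ε : ℝ≥0∞}
    (hK : ∀ᵐ w ∂U, ChiSqDominated K (κ w) ν) (hε : ∀ w, U {w} ≤ ε)
    (f : β → α) {T : Set (α × β)} (hT : MeasurableSet T) (hTf : ∀ ω ∈ T, f ω.2 = ω.1) :
    ((U ⊗ₘ κ) T) ^ 2 ≤ K * ε := by
  have hprod : (U.prod ν) T ≤ ε := by
    rw [Measure.prod_apply_symm hT]
    calc _ ≤ ∫⁻ _, ε ∂ν := by
          refine lintegral_mono fun s => (measure_mono fun w hw => ?_).trans (hε (f s))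
          exact (hTf (w, s) hw).symm
      _ = ε := by simp
  rw [Measure.compProd_apply hT]
  calc _ ≤ ∫⁻ w, (κ w (Prod.mk w ⁻¹' T)) ^ 2 ∂U :=
        sq_lintegral_le U (Kernel.measurable_kernel_prodMk_left hT)
    _ ≤ ∫⁻ w, K * ν (Prod.mk w ⁻¹' T) ∂U := by
        refine lintegral_mono_ae ?_
        filter_upwards [hK] with w hw
        have hm : MeasurableSet (Prod.mk w ⁻¹' T) := measurable_prodMk_left hT
        have := hw (Set.indicator (Prod.mk w ⁻¹' T) 1) (measurable_one.indicator hm)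
        have hsq (s : β) : (Set.indicator (Prod.mk w ⁻¹' T) (1 : β → ℝ≥0∞) s) ^ 2
            = Set.indicator (Prod.mk w ⁻¹' T) 1 s := by
          by_cases h : s ∈ Prod.mk w ⁻¹' T <;> simp [h]
        simpa only [hsq, lintegral_indicator_one hm] using this
    _ = K * (U.prod ν) T := by
        rw [lintegral_const_mul _ (measurable_measure_prodMk_left hT), Measure.prod_apply hT]
    _ ≤ K * ε := by gcongr

/-- The decoder need not be measurable: its failure event is replaced by a measurable hull, whose
complement still consists of pairs decoded correctly. -/
theorem half_le_compProd_decoding_failure {α β : Type*} [MeasurableSpace α] [MeasurableSpace β]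
    {U : Measure α} [IsProbabilityMeasure U] {κ : Kernel α β} [IsMarkovKernel κ]
    {ν : Measure β} [IsProbabilityMeasure ν] {K ε : ℝ≥0∞}
    (hK : ∀ᵐ w ∂U, ChiSqDominated K (κ w) ν) (hε : ∀ w, U {w} ≤ ε)
    (hKε : K * ε ≤ 1 / 4) (f : β → α) :
    1 / 2 ≤ (U ⊗ₘ κ) {ω | f ω.2 ≠ ω.1} := by
  set P := U ⊗ₘ κ
  set E : Set (α × β) := {ω | f ω.2 ≠ ω.1}
  have hm := measurableSet_toMeasurable P E
  have hsq : (P (toMeasurable P E)ᶜ) ^ 2 ≤ K * ε :=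
    sq_compProd_le_of_subset_graph hK hε f hm.compl fun ω hω => by
      by_contra hne
      exact hω (subset_toMeasurable P E hne)
  have hhalf : P (toMeasurable P E)ᶜ ≤ 1 / 2 := by
    refine (ENNReal.pow_le_pow_left_iff (two_ne_zero)).1 (hsq.trans (hKε.trans ?_))
    rw [one_div, one_div, ← ENNReal.inv_pow]
    norm_num
  rw [← measure_toMeasurable]
  have hadd := measure_add_measure_compl (μ := P) hm
  rw [measure_univ] at hadd
  by_contra! hlt
  have : P (toMeasurable P E) + P (toMeasurable P E)ᶜ < 1 / 2 + 1 / 2 :=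
    ENNReal.add_lt_add_of_lt_of_le (by finiteness) hlt hhalf
  rw [hadd, ENNReal.add_halves] at this
  exact lt_irrefl _ this

/-! ### Latent laws of the linear-Gaussian network -/

theorem lintegral_latentKernel_zero {p d : ℕ} (η : Fin (d + 1) → Kernel (Fin p → ℝ) (Fin p → ℝ))
    (a : Param p d × Label) (f : (Fin p → ℝ) → ℝ≥0∞) :
    ∫⁻ x, f x ∂(latentKernel id measurable_id η 0 a)
      = ∫⁻ x, f x ∂(η 0 ((a.2 : ℝ) • a.1.1)) := rfl

theorem lintegral_latentKernel_succ {p d : ℕ} (η : Fin (d + 1) → Kernel (Fin p → ℝ) (Fin p → ℝ))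
    [∀ i, IsMarkovKernel (η i)] (i : Fin d) (a : Param p d × Label)
    {f : (Fin p → ℝ) → ℝ≥0∞} (hf : Measurable f) :
    ∫⁻ x, f x ∂(latentKernel id measurable_id η i.succ a)
      = ∫⁻ z, ∫⁻ x, f x ∂(η i.succ ((a.1.2 i).mulVec z))
          ∂(latentKernel id measurable_id η i.castSucc a) := by
  change ∫⁻ x, f x ∂((latentKernel id measurable_id η i.castSucc ⊗ₖ
      (η i.succ).comap (layerMap id i) (measurable_layerMap measurable_id i)).snd a) = _
  rw [Kernel.lintegral_snd _ _ hf, Kernel.lintegral_compProd _ _ _ (f := fun b => f b.2)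
      (hf.comp measurable_snd)]
  rfl

theorem measurable_lintegral_mulVec {p q : ℕ} (η : Kernel (Fin p → ℝ) (Fin q → ℝ))
    (M : Matrix (Fin p) (Fin p) ℝ) {f : (Fin q → ℝ) → ℝ≥0∞} (hf : Measurable f) :
    Measurable fun z => ∫⁻ x, f x ∂(η (M.mulVec z)) := by
  have hM : Measurable fun z : Fin p → ℝ => M.mulVec z :=
    measurable_pi_lambda _ fun k =>
      Finset.measurable_sum (f := fun l (z : Fin p → ℝ) => M k l * z l) Finset.univ
        fun l _ => by fun_prop
  exact (hf.lintegral_kernel (κ := η)).comp hM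

/-- Replacing `w₀` by `0` costs the chi-square constant of the Gaussian first layer. The later
layers are common Markov kernels, and these cannot increase the constant, by Jensen's inequality. -/
theorem chiSqDominated_latentKernel {p d : ℕ} {v : ℝ≥0} (hv : v ≠ 0) (W : Param p d) (y : Label)
    (i : Fin (d + 1)) :
    ChiSqDominated (ENNReal.ofReal (Real.exp ((∑ k, W.1 k ^ 2) / v)))
      (latentKernel id measurable_id (fun _ => gaussianKernel p v) i (W, y))
      (latentKernel id measurable_id (fun _ => gaussianKernel p v) i ((0, W.2), y)) := by
  induction i using Fin.induction with
  | zero =>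
    intro f hf
    have hy : (y : ℝ) ^ 2 = 1 := by
      rcases y.2 with h | h
      · rw [h]; norm_num
      · rw [Set.mem_singleton_iff.1 h]; norm_num
    have h := chiSqDominated_gaussianKernel hv ((y : ℝ) • W.1) f hf
    simp only [Pi.smul_apply, smul_eq_mul, mul_pow, hy, one_mul] at h
    rw [lintegral_latentKernel_zero, lintegral_latentKernel_zero]
    simpa only [smul_zero] using h
  | succ i ih =>
    intro f hf
    rw [lintegral_latentKernel_succ _ _ _ hf, lintegral_latentKernel_succ _ _ _ (hf.pow_const 2)]
    refine (ih _ (measurable_lintegral_mulVec _ _ hf)).trans ?_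
    gcongr with z
    exact sq_lintegral_le _ hf

/-- The first-layer law with `w₀ = 0` is invariant under coordinate permutations, and so are all
later ones under permutations commuting with the layers. -/
theorem lintegral_latentKernel_comp_perm {p d : ℕ} (v : ℝ≥0) (D : Fin d → Matrix (Fin p) (Fin p) ℝ)
    (y : Label) (π : Equiv.Perm (Fin p))
    (hπ : ∀ i z, (D i).mulVec (z ∘ π) = (D i).mulVec z ∘ π) (i : Fin (d + 1))
    {f : (Fin p → ℝ) → ℝ≥0∞} (hf : Measurable f) :
    ∫⁻ x, f (x ∘ π) ∂(latentKernel id measurable_id (fun _ => gaussianKernel p v) i ((0, D), y))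
      = ∫⁻ x, f x ∂(latentKernel id measurable_id (fun _ => gaussianKernel p v) i ((0, D), y)) := by
  have hfπ {g : (Fin p → ℝ) → ℝ≥0∞} (hg : Measurable g) : Measurable fun x => g (x ∘ π) :=
    hg.comp (measurable_pi_lambda _ fun k => measurable_pi_apply (π k))
  induction i using Fin.induction generalizing f with
  | zero =>
    rw [lintegral_latentKernel_zero, lintegral_latentKernel_zero,
      lintegral_gaussianKernel_comp_perm _ _ _ hf]
    simp only [smul_zero]
    rfl
  | succ i ih =>
    rw [lintegral_latentKernel_succ _ _ _ hf, lintegral_latentKernel_succ _ _ _ (hfπ hf),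
      ← ih (measurable_lintegral_mulVec _ _ hf)]
    refine lintegral_congr fun z => ?_
    rw [lintegral_gaussianKernel_comp_perm _ _ _ hf]
    simp only [hπ]

/-- With `w₀ = 0`, composing each layer with a permutation that commutes with the layers leaves
the latent laws unchanged. -/
theorem lintegral_latentKernel_perm_layers {p d : ℕ} (v : ℝ≥0)
    (V D : Fin d → Matrix (Fin p) (Fin p) ℝ) (y : Label) (π : Fin d → Equiv.Perm (Fin p))
    (hV : ∀ i z, (V i).mulVec z = (D i).mulVec z ∘ π i)
    (hD : ∀ i j z, (D i).mulVec (z ∘ π j) = (D i).mulVec z ∘ π j) (i : Fin (d + 1))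
    {f : (Fin p → ℝ) → ℝ≥0∞} (hf : Measurable f) :
    ∫⁻ x, f x ∂(latentKernel id measurable_id (fun _ => gaussianKernel p v) i ((0, V), y))
      = ∫⁻ x, f x ∂(latentKernel id measurable_id (fun _ => gaussianKernel p v) i ((0, D), y)) := by
  induction i using Fin.induction generalizing f with
  | zero => rfl
  | succ i ih =>
    rw [lintegral_latentKernel_succ _ _ _ hf, lintegral_latentKernel_succ _ _ _ hf,
      ih (measurable_lintegral_mulVec _ _ hf),
      ← lintegral_latentKernel_comp_perm v D y (π i) (fun k z => hD k i z) i.castSucc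
        (measurable_lintegral_mulVec _ (D i) hf)]
    refine lintegral_congr fun z => ?_
    simp only [hV, hD]

/-! ### The layer class -/

/-- The element of `layerClass h` with permutation `τ`. -/
noncomputable def blockLayer {p r : ℕ} (h : r ≤ p) (τ : Equiv.Perm (Fin r)) :
    Matrix (Fin p) (Fin p) ℝ :=
  Matrix.reindex (blockEquiv h) (blockEquiv h)
    (Matrix.fromBlocks (τ.permMatrix ℝ) 0 0
      ((1 / ((p : ℝ) - (r : ℝ) + 1)) • (1 : Matrix (Fin (p - r)) (Fin (p - r)) ℝ)))

/-- The permutation of `p` coordinates that acts as `τ` on the first `r` and fixes the others. -/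
def blockPerm {p r : ℕ} (h : r ≤ p) (τ : Equiv.Perm (Fin r)) : Equiv.Perm (Fin p) :=
  (blockEquiv h).permCongr (Equiv.sumCongr τ (Equiv.refl _))

theorem blockLayer_mulVec {p r : ℕ} (h : r ≤ p) (τ : Equiv.Perm (Fin r)) (z : Fin p → ℝ)
    (s : Fin r ⊕ Fin (p - r)) :
    (blockLayer h τ).mulVec z (blockEquiv h s)
      = Sum.elim (fun i => z (blockEquiv h (Sum.inl (τ i))))
          (fun j => (1 / ((p : ℝ) - (r : ℝ) + 1)) * z (blockEquiv h (Sum.inr j))) s := by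
  rw [blockLayer, Matrix.reindex_apply, Matrix.submatrix_mulVec_equiv, Function.comp_apply,
    Equiv.symm_apply_apply, Equiv.symm_symm, Matrix.fromBlocks_mulVec, Matrix.permMatrix_mulVec]
  cases s <;> simp [Matrix.smul_mulVec]

theorem blockLayer_mulVec_eq_comp {p r : ℕ} (h : r ≤ p) (τ : Equiv.Perm (Fin r))
    (z : Fin p → ℝ) :
    (blockLayer h τ).mulVec z = (blockLayer h 1).mulVec z ∘ blockPerm h τ := by
  funext k
  obtain ⟨s, rfl⟩ := (blockEquiv h).surjective k
  cases s <;> simp [blockLayer_mulVec, blockPerm, Equiv.permCongr_apply]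

theorem blockLayer_one_mulVec_comp {p r : ℕ} (h : r ≤ p) (τ : Equiv.Perm (Fin r))
    (z : Fin p → ℝ) :
    (blockLayer h 1).mulVec (z ∘ blockPerm h τ) = (blockLayer h 1).mulVec z ∘ blockPerm h τ := by
  funext k
  obtain ⟨s, rfl⟩ := (blockEquiv h).surjective k
  cases s <;> simp [blockLayer_mulVec, blockPerm, Equiv.permCongr_apply]

theorem blockLayer_injective {p r : ℕ} (h : r ≤ p) :
    Function.Injective (blockLayer h : Equiv.Perm (Fin r) → _) := by
  intro τ τ' hτ
  have h1 := (Matrix.fromBlocks_inj.1 ((Matrix.reindex _ _).injective hτ)).1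
  ext i : 1
  have h2 := congrFun (congrFun h1 i) (τ i)
  by_contra hne
  simp [Equiv.Perm.permMatrix, PEquiv.toMatrix_apply, Equiv.toPEquiv_apply, Ne.symm hne] at h2

/-! ### Laws of the data -/

/-- The parameter of the reference law: `w₀ = 0` and no permutation in any layer. -/
noncomputable def referenceParam {p r : ℕ} (d : ℕ) (h : r ≤ p) : Param p d :=
  (0, fun _ => blockLayer h 1)

theorem chiSqDominated_networkKernel {p d r : ℕ} {h : r ≤ p} {v : ℝ≥0} (hv : v ≠ 0)
    (label : Measure Label) [IsProbabilityMeasure label] {W : Param p d}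
    (hW : ∀ i, W.2 i ∈ layerClass h) :
    ChiSqDominated (ENNReal.ofReal (Real.exp ((∑ k, W.1 k ^ 2) / v)))
      (networkKernel id measurable_id label (fun _ => gaussianKernel p v) W)
      (networkKernel id measurable_id label (fun _ => gaussianKernel p v)
        (referenceParam d h)) := by
  choose τ hτ using hW
  have key (W : Param p d) (g : Sample p → ℝ≥0∞) (hg : Measurable g) :
      ∫⁻ s, g s ∂(networkKernel id measurable_id label (fun _ => gaussianKernel p v) W)
        = ∫⁻ y, ∫⁻ x, g (x, y) ∂(latentKernel id measurable_id
            (fun _ => gaussianKernel p v) (Fin.last d) (W, y)) ∂label := by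
    rw [networkKernel, Kernel.lintegral_swapRight _ _ hg,
      Kernel.lintegral_compProd _ _ _ (f := fun b => g b.swap)
        (hg.comp measurable_swap), Kernel.const_apply]
    rfl
  intro f hf
  have hmeas : Measurable fun y => ∫⁻ x, f (x, y) ∂(latentKernel id measurable_id
      (fun _ => gaussianKernel p v) (Fin.last d) (W, y)) := by
    have := (hf.comp measurable_swap).lintegral_kernel_prod_right'
      (κ := (latentKernel id measurable_id (fun _ => gaussianKernel p v) (Fin.last d)).comap
        (fun y : Label => (W, y)) measurable_prodMk_left)
    exact this
  have hsec (y : Label) : Measurable fun x : Fin p → ℝ => f (x, y) ^ 2 :=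
    (hf.comp measurable_prodMk_right).pow_const 2
  rw [key W f hf, key _ _ (hf.pow_const 2)]
  refine (sq_lintegral_le label hmeas).trans ?_
  have hrhs : ∫⁻ y, ∫⁻ x, f (x, y) ^ 2 ∂(latentKernel id measurable_id
        (fun _ => gaussianKernel p v) (Fin.last d) ((0, W.2), y)) ∂label
      = ∫⁻ y, ∫⁻ x, f (x, y) ^ 2 ∂(latentKernel id measurable_id
        (fun _ => gaussianKernel p v) (Fin.last d) (referenceParam d h, y)) ∂label := by
    refine lintegral_congr fun y => ?_
    refine lintegral_latentKernel_perm_layers v _ _ y (fun i => blockPerm h (τ i))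
      (fun i z => ?_) (fun _ j z => blockLayer_one_mulVec_comp h (τ j) z) _ (hsec y)
    rw [hτ i]
    exact blockLayer_mulVec_eq_comp h (τ i) z
  rw [← hrhs, ← lintegral_const_mul' _ _ ENNReal.ofReal_ne_top]
  exact lintegral_mono fun y =>
    chiSqDominated_latentKernel hv W y (Fin.last d) _ (hf.comp measurable_prodMk_right)

/-! ### The finite class -/

/-- The parameter with signs `b` and layer permutations `τ`. -/
noncomputable def netParam {p r d : ℕ} (h : r ≤ p)
    (a : (Fin p → Bool) × (Fin d → Equiv.Perm (Fin r))) : Param p d :=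
  (fun k => bif a.1 k then 1 / √(2 ^ min ((k : ℕ) + 1) (p - 1))
    else -1 / √(2 ^ min ((k : ℕ) + 1) (p - 1)), fun i => blockLayer h (a.2 i))

theorem netParam_injective {p r d : ℕ} (h : r ≤ p) :
    Function.Injective (netParam (d := d) h) := by
  rintro ⟨b, τ⟩ ⟨b', τ'⟩ hab
  obtain ⟨h1, h2⟩ := Prod.ext_iff.1 hab
  refine Prod.ext (funext fun k => ?_) (funext fun i => blockLayer_injective h (congrFun h2 i))
  have hk := congrFun h1 k
  have hpos : 0 < 1 / √((2 : ℝ) ^ min ((k : ℕ) + 1) (p - 1)) := by positivity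
  simp only [netParam, neg_div] at hk
  change b k = b' k
  cases hb : b k <;> cases hb' : b' k <;> simp only [hb, hb', cond_true, cond_false] at hk ⊢ <;>
    linarith

theorem netClass_eq_range {p r : ℕ} (d : ℕ) (h : r ≤ p) :
    netClass d h = Set.range (netParam (d := d) h) := by
  ext W
  constructor
  · rintro ⟨hw, hW⟩
    choose τ hτ using hW
    classical
    refine ⟨(fun k => decide (W.1 k = 1 / √(2 ^ min ((k : ℕ) + 1) (p - 1))), τ),
      Prod.ext (funext fun k => ?_) (funext fun i => (hτ i).symm)⟩
    by_cases hk : W.1 k = 1 / √(2 ^ min ((k : ℕ) + 1) (p - 1))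
    · simp [netParam, hk]
    · simp only [netParam, hk, decide_false, cond_false]
      exact ((hw k).resolve_left hk).symm
  · rintro ⟨⟨b, τ⟩, rfl⟩
    refine ⟨fun k => ?_, fun i => ⟨τ i, rfl⟩⟩
    cases hb : b k <;> simp [netParam, hb]

theorem finite_netClass {p r : ℕ} (d : ℕ) (h : r ≤ p) : (netClass d h).Finite := by
  rw [netClass_eq_range]
  exact Set.finite_range _

theorem nonempty_netClass {p r : ℕ} (d : ℕ) (h : r ≤ p) : (netClass d h).Nonempty := by
  rw [netClass_eq_range]
  exact Set.range_nonempty _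

theorem ncard_netClass {p r : ℕ} (d : ℕ) (h : r ≤ p) :
    (netClass d h).ncard = 2 ^ p * r.factorial ^ d := by
  rw [netClass_eq_range, Set.ncard, Set.encard_eq_coe_toFinset_card, Set.toFinset_range,
    ENat.toNat_natCast, Finset.card_image_of_injective _ (netParam_injective h)]
  simp [Fintype.card_perm]

instance measurableSingletonClass_matrix (m k : ℕ) :
    MeasurableSingletonClass (Matrix (Fin m) (Fin k) ℝ) :=
  inferInstanceAs (MeasurableSingletonClass (Fin m → Fin k → ℝ))

theorem isProbabilityMeasure_uniformOn_netClass {p r : ℕ} (d : ℕ) (h : r ≤ p) :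
    IsProbabilityMeasure (uniformOn (netClass d h)) :=
  isProbabilityMeasure_uniformOn (finite_netClass d h) (nonempty_netClass d h)

theorem uniformOn_singleton_le {α : Type*} [MeasurableSpace α] [MeasurableSingletonClass α]
    {s : Set α} (hs : s.Finite) (a : α) : uniformOn s {a} ≤ (s.ncard : ℝ≥0∞)⁻¹ := by
  rw [uniformOn, cond_apply hs.measurableSet, Measure.count_apply hs.measurableSet,
    ← hs.cast_ncard_eq]
  calc _ ≤ ((s.ncard : ℕ∞) : ℝ≥0∞)⁻¹ * Measure.count {a} := by
        gcongr
        exact Set.inter_subset_right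
    _ = _ := by rw [Measure.count_singleton, mul_one]; simp

/-- For `p ≥ 2` the squared entries are `1/2, 1/4, …, 1/2^{p-1}, 1/2^{p-1}`, with sum `1`; for
`p = 1` the only one is `1`. -/
theorem sum_sq_le_one {p : ℕ} {w : Fin p → ℝ} (hw : w ∈ signClass p) : ∑ k, w k ^ 2 ≤ 1 := by
  have hsq (k : Fin p) : w k ^ 2 = 1 / 2 ^ min ((k : ℕ) + 1) (p - 1) := by
    rcases hw k with h | h <;> rw [h, div_pow, Real.sq_sqrt (by positivity)] <;> norm_num
  simp_rw [hsq]
  cases p with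
  | zero => simp
  | succ q =>
    rw [Fin.sum_univ_castSucc]
    have hgeom (m : ℕ) : ∑ k : Fin m, (1 : ℝ) / 2 ^ ((k : ℕ) + 1) = 1 - 1 / 2 ^ m := by
      induction m with
      | zero => simp
      | succ m ih =>
        rw [Fin.sum_univ_castSucc]
        simp only [Fin.val_castSucc, Fin.val_last, ih]
        field_simp
        ring
    simp [-one_div, hgeom]

/-! ### Exact recovery fails -/

theorem subFamily_subset_fullFamily {p r : ℕ} (d n : ℕ) (h : r ≤ p) (σ : ℝ≥0) :
    subFamily d n h σ ⊆ fullFamily p d n := by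
  rintro P ⟨π, hπ, κ, hκ, hM, rfl⟩
  rw [Set.mem_singleton_iff] at hπ
  rw [linearGaussianModels, Set.mem_singleton_iff] at hκ
  refine ⟨π, ?_, κ, ?_, hM, rfl⟩
  · rw [hπ]
    exact isProbabilityMeasure_uniformOn_netClass d h
  · exact ⟨id, measurable_id, uniformOn Set.univ, fun _ => gaussianKernel p (σ ^ 2),
      inferInstance, inferInstance, hκ⟩

instance isMarkovKernel_iidKernel {p d n : ℕ} (κ : Kernel (Param p d) (Sample p))
    [IsMarkovKernel κ] : IsMarkovKernel (iidKernel n κ) :=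
  isMarkovKernel_piKernel _

theorem chiSqDominated_iidKernel {p d r n : ℕ} {h : r ≤ p} {σ : ℝ≥0} (hσ : 0 < σ)
    {W : Param p d} (hW : W ∈ netClass d h) :
    ChiSqDominated (ENNReal.ofReal (Real.exp (n / (σ : ℝ) ^ 2)))
      (iidKernel n (networkKernel id measurable_id (uniformOn Set.univ)
        (fun _ => gaussianKernel p (σ ^ 2))) W)
      (iidKernel n (networkKernel id measurable_id (uniformOn Set.univ)
        (fun _ => gaussianKernel p (σ ^ 2))) (referenceParam d h)) := by
  intro f hf
  refine (ChiSqDominated.pi (fun _ : Fin n => chiSqDominated_networkKernel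
    (pow_pos hσ 2).ne' (uniformOn Set.univ) hW.2) f hf).trans ?_
  refine mul_le_mul_left ?_ _
  rw [Finset.prod_const, Finset.card_univ, Fintype.card_fin,
    ← ENNReal.ofReal_pow (Real.exp_pos _).le, ← Real.exp_nat_mul]
  refine ENNReal.ofReal_le_ofReal (Real.exp_le_exp.2 ?_)
  rw [NNReal.coe_pow, ← mul_one_div (n : ℝ)]
  gcongr
  exact sum_sq_le_one hW.1

theorem half_le_minimaxFailure {p d r n : ℕ} {h : r ≤ p} {σ : ℝ≥0} (hσ : 0 < σ)
    (hn : (n : ℝ) / (σ : ℝ) ^ 2 + Real.log 4 ≤ Real.log ((netClass d h).ncard)) :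
    1 / 2 ≤ minimaxFailure (netClass d h) (subFamily d n h σ) := by
  have := isProbabilityMeasure_uniformOn_netClass d h
  refine le_iInf fun f => ?_
  refine le_iSup₂_of_le (uniformOn (netClass d h) ⊗ₘ iidKernel n (networkKernel id measurable_id
    (uniformOn Set.univ) (fun _ => gaussianKernel p (σ ^ 2))))
    ⟨_, rfl, _, rfl, inferInstance, rfl⟩ ?_
  have hM : 0 < ((netClass d h).ncard : ℝ) := by
    exact_mod_cast (Set.ncard_pos (finite_netClass d h)).2 (nonempty_netClass d h)
  refine half_le_compProd_decoding_failure
    (K := ENNReal.ofReal (Real.exp (n / (σ : ℝ) ^ 2))) (ε := ((netClass d h).ncard : ℝ≥0∞)⁻¹)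
    (ν := iidKernel n (networkKernel id measurable_id (uniformOn Set.univ)
        (fun _ => gaussianKernel p (σ ^ 2))) (referenceParam d h))
    ?_ (uniformOn_singleton_le (finite_netClass d h)) ?_ (fun s => (f s : Param p d))
  · filter_upwards [ae_cond_mem (μ := Measure.count) (finite_netClass d h).measurableSet]
      with W hW
    exact chiSqDominated_iidKernel hσ hW
  · rw [← ENNReal.ofReal_natCast, ← ENNReal.ofReal_inv_of_pos hM,
      ← ENNReal.ofReal_mul (Real.exp_pos _).le]
    have h4 : (1 / 4 : ℝ≥0∞) = ENNReal.ofReal (1 / 4) := by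
      rw [ENNReal.ofReal_div_of_pos (by norm_num)]; simp
    rw [h4]
    refine ENNReal.ofReal_le_ofReal ?_
    have := Real.exp_le_exp.2 hn
    rw [Real.exp_add, Real.exp_log (by norm_num), Real.exp_log hM] at this
    rw [← div_eq_mul_inv, div_le_iff₀ hM]
    linarith

theorem log_ncard_netClass {p r : ℕ} (d : ℕ) (h : r ≤ p) :
    Real.log ((netClass d h).ncard) = d * Real.log (r.factorial) + p * Real.log 2 := by
  rw [ncard_netClass]
  push_cast
  rw [Real.log_mul (by positivity) (by positivity), Real.log_pow, Real.log_pow, add_comm]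

theorem sum_log_eq_log_factorial (r : ℕ) :
    ∑ i ∈ Finset.Icc 1 r, Real.log (i : ℝ) = Real.log (r.factorial) := by
  induction r with
  | zero => simp
  | succ r ih =>
    rw [Finset.sum_Icc_succ_top (by omega), ih, Nat.factorial_succ, Nat.cast_mul,
      Real.log_mul (by positivity) (by positivity), add_comm]

/-- Pairing the factors `i + 1` and `r - i` of the two copies of `r!`, each product is at
least `r`. -/
theorem pow_self_le_factorial_sq (r : ℕ) : r ^ r ≤ r.factorial ^ 2 := by
  calc r ^ r = ∏ _i ∈ Finset.range r, r := by simp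
    _ ≤ ∏ i ∈ Finset.range r, (i + 1) * (r - 1 - i + 1) := by
        refine Finset.prod_le_prod' fun i hi => ?_
        obtain ⟨j, rfl⟩ := Nat.exists_eq_add_of_lt (Finset.mem_range.1 hi)
        have : i + j + 1 - 1 - i + 1 = j + 1 := by omega
        rw [this]
        nlinarith
    _ = r.factorial ^ 2 := by
        rw [Finset.prod_mul_distrib, Finset.prod_range_reflect (fun i => i + 1),
          Finset.prod_range_add_one_eq_factorial, sq]

theorem self_mul_log_self_le (r : ℕ) : (r : ℝ) * Real.log r ≤ 2 * Real.log r.factorial := by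
  rcases Nat.eq_zero_or_pos r with rfl | hr
  · simp
  · have h : ((r : ℝ) ^ r) ≤ (r.factorial : ℝ) ^ 2 := by exact_mod_cast pow_self_le_factorial_sq r
    have := Real.log_le_log (by positivity) h
    rwa [Real.log_pow, Real.log_pow] at this

end BackwardNet

theorem theorem3p1 :
    (∀ (p d r n : ℕ) (h : r ≤ p) (σ : ℝ≥0), 0 < σ →
      BackwardNet.subFamily d n h σ ⊆ BackwardNet.fullFamily p d n ∧
      ((n : ℝ) ≤ (σ : ℝ) ^ 2 * ((d : ℝ) * (∑ i ∈ Finset.Icc 1 r, Real.log (i : ℝ))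
          + (p : ℝ) * Real.log 2 - Real.log 4) / 4 →
        1 / 2 ≤ BackwardNet.minimaxFailure (BackwardNet.netClass d h)
          (BackwardNet.subFamily d n h σ))) ∧
    (∃ C : ℝ, 0 < C ∧ ∀ (p d r n : ℕ) (h : r ≤ p) (σ : ℝ≥0), 3 ≤ p → 0 < σ →
      (n : ℝ) ≤ C * (σ : ℝ) ^ 2 * ((d : ℝ) * (r : ℝ) * Real.log (r : ℝ) + (p : ℝ)) →
        1 / 2 ≤ BackwardNet.minimaxFailure (BackwardNet.netClass d h)
          (BackwardNet.subFamily d n h σ)) := by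
  have main : ∀ (p d r n : ℕ) (h : r ≤ p) (σ : ℝ≥0), 0 < σ →
      (n : ℝ) ≤ (σ : ℝ) ^ 2 * ((d : ℝ) * (∑ i ∈ Finset.Icc 1 r, Real.log (i : ℝ))
          + (p : ℝ) * Real.log 2 - Real.log 4) / 4 →
        1 / 2 ≤ BackwardNet.minimaxFailure (BackwardNet.netClass d h)
          (BackwardNet.subFamily d n h σ) := by
    intro p d r n h σ hσ hn
    refine BackwardNet.half_le_minimaxFailure hσ ?_
    rw [BackwardNet.log_ncard_netClass, ← BackwardNet.sum_log_eq_log_factorial]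
    have hσ2 : 0 < (σ : ℝ) ^ 2 := by positivity
    have h0 : 0 ≤ (n : ℝ) / (σ : ℝ) ^ 2 := by positivity
    have h1 : (n : ℝ) / (σ : ℝ) ^ 2 ≤ ((d : ℝ) * (∑ i ∈ Finset.Icc 1 r, Real.log (i : ℝ))
        + (p : ℝ) * Real.log 2 - Real.log 4) / 4 := by
      rw [div_le_iff₀ hσ2]
      linarith
    linarith
  refine ⟨fun p d r n h σ hσ => ⟨BackwardNet.subFamily_subset_fullFamily d n h σ,
    main p d r n h σ hσ⟩, 1 / 20, by norm_num, fun p d r n h σ hp hσ hn => ?_⟩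
  refine main p d r n h σ hσ (hn.trans ?_)
  have hlog4 : Real.log 4 = 2 * Real.log 2 := by
    rw [show (4 : ℝ) = 2 ^ 2 by norm_num, Real.log_pow]
    norm_num
  have hp3 : (3 : ℝ) ≤ p := by exact_mod_cast hp
  have hlog2 := Real.log_two_gt_d9
  -- `(p - 2) log 2 ≥ (p / 3) log 2 ≥ p / 5` since `p ≥ 3`
  have h1 : (p : ℝ) / 5 ≤ (p : ℝ) * Real.log 2 - Real.log 4 := by
    rw [hlog4]
    nlinarith
  have h2 : (d : ℝ) * ((r : ℝ) * Real.log r) ≤ d * (2 * Real.log r.factorial) :=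
    mul_le_mul_of_nonneg_left (BackwardNet.self_mul_log_self_le r) (Nat.cast_nonneg d)
  have h3 : 0 ≤ (d : ℝ) * Real.log r.factorial := by positivity
  rw [BackwardNet.sum_log_eq_log_factorial]
  have h4 : 1 / 20 * ((d : ℝ) * r * Real.log r + p)
      ≤ ((d : ℝ) * Real.log r.factorial + p * Real.log 2 - Real.log 4) / 4 := by
    linarith
  calc _ = (σ : ℝ) ^ 2 * (1 / 20 * ((d : ℝ) * r * Real.log r + p)) := by ring
    _ ≤ (σ : ℝ) ^ 2 * (((d : ℝ) * Real.log r.factorial + p * Real.log 2 - Real.log 4) / 4) := by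
        gcongr
    _ = _ := by ring
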